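/- Let $\mathbb{k}\in\{\mathbb{R},\mathbb{C}\}$, let $\mathbb{F}_d$ be the free group on $s_1,\dots,s_d$, let $H$ be a Hilbert space over $\mathbb{k}$, and let $\mathbb{B}(H)[\mathbb{F}_d]$ be the group algebra of finitely supported functions $f:\mathbb{F}_d\to\mathbb{B}(H)$, with the convolution product $(f*g)(s)=\sum_t f(st^{-1})g(t)$ and the involution $f^*(s)=f(s^{-1})^*$. Call $E\subset\mathbb{F}_d$ grounded if $1\in E$ and $E$ is connected in the Cayley graph in which $s,t$ are adjacent iff $st^{-1}\in\{s_1^{\pm1},\dots,s_d^{\pm1}\}$. (1) Let $f=f^*\in\mathbb{B}(H)[\mathbb{F}_d]$ and let $E\subset\mathbb{F}_d$ be grounded with $\operatorname{supp} f\subset E^{-1}E$. Assume that $(\mathrm{id}\otimes\pi)(f)=\sum_{a} f(a)\otimes\pi(a)\ge 0$ for every finite-dimensional unitary representation $\pi$ of $\mathbb{F}_d$ over $\mathbb{k}$ of dimension at most $2|E|\dim H$ (no restriction on the finite dimension of $\pi$ if $H\neq 0$ and $|E|$ or $\dim H$ is infinite). Then there are an integer $n\le|E|$ and $\xi_1,\dots,\xi_n\in\mathbb{B}(H)[\mathbb{F}_d]$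 with $\operatorname{supp}\xi_i\subset E$ such that $f=\sum_{i=1}^n\xi_i^**\xi_i$. If $\dim H=\infty$, one may take $n=1$. (2) Consequently, the cone $\mathbb{k}[\mathbb{F}_d]_+=\{\sum_{i=1}^n\xi_i^**\xi_i : n\in\mathbb{N},\ \xi_i\in\mathbb{k}[\mathbb{F}_d]\}$ is archimedean closed: for $a=a^*\in\mathbb{k}[\mathbb{F}_d]$, if $a+\varepsilon 1\in\mathbb{k}[\mathbb{F}_d]_+$ for every $\varepsilon>0$, then $a\in\mathbb{k}[\mathbb{F}_d]_+$. -/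

import Mathlib

open scoped TensorProduct Pointwise

noncomputable section

/-- The involution of the group algebra `R[G]` over a star ring `R`: `f^*(s) = f(s⁻¹)^*`. -/
instance groupAlgebraStar {R G : Type*} [Semiring R] [StarRing R] [Group G] :
    Star (MonoidAlgebra R G) where
  star f := MonoidAlgebra.ofCoeff
    ((f.coeff.mapRange star (star_zero R)).equivMapDomain (Equiv.inv G))

theorem groupAlgebra_coeff_star {R G : Type*} [Semiring R] [StarRing R] [Group G]
    (f : MonoidAlgebra R G) (s : G) : (star f).coeff s = star (f.coeff s⁻¹) := by
  simp [star]

theorem groupAlgebra_star_add {R G : Type*} [Semiring R] [StarRing R] [Group G]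
    (f g : MonoidAlgebra R G) : star (f + g) = star f + star g := by
  ext s
  simp [groupAlgebra_coeff_star]

theorem groupAlgebra_star_zero {R G : Type*} [Semiring R] [StarRing R] [Group G] :
    star (0 : MonoidAlgebra R G) = 0 := by
  ext s
  simp [groupAlgebra_coeff_star]

theorem groupAlgebra_star_single {R G : Type*} [Semiring R] [StarRing R] [Group G]
    (a : G) (r : R) :
    star (MonoidAlgebra.single a r) = MonoidAlgebra.single a⁻¹ (star r) := by
  classical
  ext s
  rw [groupAlgebra_coeff_star, MonoidAlgebra.coeff_single, MonoidAlgebra.coeff_single,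
    Finsupp.single_apply, Finsupp.single_apply]
  by_cases h : a = s⁻¹
  · simp [h]
  · rw [if_neg h, if_neg (fun h' => h (by simp [← h'])), star_zero]

/-- With this involution the group algebra is a `*`-ring. -/
instance groupAlgebraStarRing {R G : Type*} [Semiring R] [StarRing R] [Group G] :
    StarRing (MonoidAlgebra R G) where
  star_involutive f := by
    ext s
    simp [groupAlgebra_coeff_star]
  star_add := groupAlgebra_star_add
  star_mul f g := by
    induction f using MonoidAlgebra.induction_linear with
    | zero => simp [groupAlgebra_star_zero]
    | add f₁ f₂ h₁ h₂ => rw [add_mul, groupAlgebra_star_add, h₁, h₂, groupAlgebra_star_add, mul_add]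
    | single a r =>
      induction g using MonoidAlgebra.induction_linear with
      | zero => simp [groupAlgebra_star_zero]
      | add g₁ g₂ h₁ h₂ =>
        rw [mul_add, groupAlgebra_star_add, h₁, h₂, groupAlgebra_star_add, add_mul]
      | single b t =>
        simp only [groupAlgebra_star_single, MonoidAlgebra.single_mul_single, star_mul,
          mul_inv_rev]

/-- The Cayley graph of the free group of rank `d`: `s` and `t` are adjacent iff
`s t⁻¹` is a canonical generator or the inverse of one. -/
def freeCayleyGraph (d : ℕ) : SimpleGraph (FreeGroup (Fin d)) where
  Adj s t := ∃ i : Fin d, s * t⁻¹ = FreeGroup.of i ∨ s * t⁻¹ = (FreeGroup.of i)⁻¹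
  symm := ⟨by
    rintro s t ⟨i, h | h⟩
    · exact ⟨i, Or.inr (by rw [← h]; group)⟩
    · exact ⟨i, Or.inl (by rw [← inv_inv (FreeGroup.of i), ← h]; group)⟩⟩
  loopless := ⟨by
    rintro s ⟨i, h | h⟩
    · rw [mul_inv_cancel] at h
      exact FreeGroup.of_ne_one i h.symm
    · rw [mul_inv_cancel] at h
      exact FreeGroup.of_ne_one i (inv_eq_one.mp h.symm)⟩

/-- A subset of the free group is grounded if it contains the unit and is connected in the
Cayley graph. -/
def IsGrounded {d : ℕ} (E : Set (FreeGroup (Fin d))) : Prop :=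
  1 ∈ E ∧ ((freeCayleyGraph d).induce E).Connected

/-- The operator `(id ⊗ π)(f) = ∑ₐ f(a) ⊗ π(a)` on `H ⊗ K`, for `f ∈ B(H)[G]` and a unitary
representation `π` of `G` on `K`. For finite-dimensional `K` the algebraic tensor product
`H ⊗ K` is already the Hilbert space tensor product. -/
def evalRep {𝕜 G H K : Type*} [RCLike 𝕜] [Group G]
    [NormedAddCommGroup H] [InnerProductSpace 𝕜 H]
    [NormedAddCommGroup K] [InnerProductSpace 𝕜 K] [CompleteSpace K]
    (π : G →* unitary (K →L[𝕜] K)) (f : MonoidAlgebra (H →L[𝕜] H) G) :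
    (H ⊗[𝕜] K) →ₗ[𝕜] (H ⊗[𝕜] K) :=
  ∑ a ∈ f.coeff.support,
    TensorProduct.map (f.coeff a : H →ₗ[𝕜] H) ((π a : K →L[𝕜] K) : K →ₗ[𝕜] K)

/-- The cone of finite sums of hermitian squares `∑ ξᵢ^* ξᵢ`. -/
def sosCone (A : Type*) [Semiring A] [StarRing A] : Set A :=
  {a | ∃ (n : ℕ) (ξ : Fin n → A), a = ∑ i, star (ξ i) * ξ i}

/-- The archimedean closure of a cone `C`: the hermitian `a` with `a + ε 1 ∈ C` for all
real `ε > 0`. -/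
def archClosure (𝕜 : Type*) {A : Type*} [RCLike 𝕜] [Semiring A] [StarRing A] [Module 𝕜 A]
    (C : Set A) : Set A :=
  {a | IsSelfAdjoint a ∧ ∀ ε : ℝ, 0 < ε → a + (ε : 𝕜) • (1 : A) ∈ C}

/-- A cone is archimedean closed if it equals its archimedean closure. -/
def IsArchClosed (𝕜 : Type*) {A : Type*} [RCLike 𝕜] [Semiring A] [StarRing A] [Module 𝕜 A]
    (C : Set A) : Prop :=
  C = archClosure 𝕜 C

end

open scoped ComplexOrder

/-!
A factorization `f = ∑ ξᵢ^* ξᵢ` with `supp ξᵢ ⊆ E` amounts to a positive semidefinite matrix `T`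
indexed by `E × I`, where `I` indexes a Hilbert basis `b` of `H`, whose sums
`∑_{x⁻¹y = a} T ((x, i), (y, j))` along the block diagonals are `⟪b i, f(a) b j⟫`: write `T` as a
Gram matrix of vectors in copies of `H` and read off the coefficients of the `ξᵢ`.

These sums prescribe the functional `K ↦ ∑ K T` on the block Toeplitz kernels `K`. A positive
multiple of the identity kernel is Toeplitz, and finitely many such diagonals dominate any finitely
supported kernel, so by the M. Riesz extension theorem a suitable `T` exists as soon as the
prescribed functional is nonnegative on the positive semidefinite Toeplitz kernels.

Such a kernel, restricted to finitely many basis vectors, is the Gram matrix of vectors `g x i`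
with `⟪g x i, g y j⟫` depending only on `x⁻¹y`. For each generator `s` the partial isometry
`g x i ↦ g (s x) i` extends to a unitary. Freeness of the group turns these unitaries into a
representation `π`, and connectedness of `E` gives `π x (g 1 i) = g x i` for `x ∈ E`. The value of
the functional is therefore that of the quadratic form of `(id ⊗ π)(f)` at `∑ b i ⊗ g 1 i`.
-/

/-! ### Positive semidefinite kernels -/

theorem posSemidef_of_re_nonneg {𝕜 κ : Type*} [RCLike 𝕜] {M : Matrix κ κ 𝕜} (hM : M.IsHermitian)
    (h : ∀ z : κ →₀ 𝕜, 0 ≤ RCLike.re (z.sum fun p a => z.sum fun q b => star a * M p q * b)) :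
    M.PosSemidef := by
  refine ⟨hM, fun z => RCLike.nonneg_iff.2 ⟨h z, RCLike.conj_eq_iff_im.1 ?_⟩⟩
  simp only [map_finsuppSum, ← RCLike.star_def, star_mul', star_star, hM.apply, mul_comm, mul_assoc]
  exact Finsupp.sum_comm ..

theorem nonempty_embedding_of_orthonormal {𝕜 K ι ι' : Type*} [RCLike 𝕜] [NormedAddCommGroup K]
    [InnerProductSpace 𝕜 K] {b : ι → K} (hb : Orthonormal 𝕜 b) {v : ι' → K}
    (hv : Dense (Submodule.span 𝕜 (Set.range v) : Set K)) : Nonempty (ι ↪ ι') := by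
  rcases finite_or_infinite ι' with hι' | hι'
  · have := FiniteDimensional.span_of_finite 𝕜 (Set.finite_range v)
    have hspan : Submodule.span 𝕜 (Set.range v) = ⊤ := by
      rwa [Submodule.dense_iff_topologicalClosure_eq_top,
        (Submodule.closed_of_finiteDimensional _).submodule_topologicalClosure_eq] at hv
    have := Fintype.ofFinite ι'
    classical
    have hle := linearIndependent_le_span b hb.linearIndependent (Set.range v) hspan
    have : Finite ι := Cardinal.lt_aleph0_iff_finite.1 (hle.trans_lt Cardinal.natCast_lt_aleph0)
    have := Fintype.ofFinite ι
    rw [Cardinal.mk_fintype, Nat.cast_le] at hle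
    exact Function.Embedding.nonempty_of_card_le (hle.trans (Fintype.card_range_le v))
  · have hne : ∀ i, ∃ p, inner 𝕜 (b i) (v p) ≠ 0 := by
      intro i
      by_contra! h
      have hle : Submodule.span 𝕜 (Set.range v) ≤ LinearMap.ker (innerₛₗ 𝕜 (b i)) :=
        Submodule.span_le.2 (Set.range_subset_iff.2 h)
      exact hb.ne_zero i (hv.eq_zero_of_inner_left 𝕜 fun x hx => hle hx)
    choose p hp using hne
    have hcount : ∀ q, {i | p i = q}.Countable := fun q =>
      (hb.inner_products_summable (v q)).countable_support.mono (by
        rintro i rfl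
        simpa using hp i)
    refine Cardinal.lift_mk_le'.1 ?_
    calc Cardinal.lift (Cardinal.mk ι) ≤ Cardinal.lift (Cardinal.mk ι') * Cardinal.aleph0 :=
          Cardinal.lift_mk_le_lift_mk_mul_of_lift_mk_preimage_le p fun q => by
            simpa using hcount q
      _ = Cardinal.lift (Cardinal.mk ι') := Cardinal.mul_aleph0_eq (by simp)

theorem exists_linearIsometry_of_dense_span {𝕜 K L ι : Type*} [RCLike 𝕜] [NormedAddCommGroup K]
    [InnerProductSpace 𝕜 K] [CompleteSpace K] [NormedAddCommGroup L] [InnerProductSpace 𝕜 L]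
    [CompleteSpace L] {v : ι → K} (hv : Dense (Submodule.span 𝕜 (Set.range v) : Set K))
    {e : ι → L} (he : Orthonormal 𝕜 e) : Nonempty (K →ₗᵢ[𝕜] L) := by
  obtain ⟨w, b, -⟩ := exists_hilbertBasis 𝕜 K
  obtain ⟨φ⟩ := nonempty_embedding_of_orthonormal b.orthonormal hv
  exact ⟨(he.comp φ φ.injective).orthogonalFamily.linearIsometry.comp b.repr.toLinearIsometry⟩

theorem exists_inner_eq_of_posSemidef {𝕜 κ L : Type*} [RCLike 𝕜] [NormedAddCommGroup L]
    [InnerProductSpace 𝕜 L] [CompleteSpace L] {e : κ → L} (he : Orthonormal 𝕜 e)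
    {M : Matrix κ κ 𝕜} (hM : M.PosSemidef) :
    ∃ u : κ → L, ∀ p q, inner 𝕜 (u p) (u q) = M p q := by
  let N : Matrix κ κ (𝕜 →L[𝕜] 𝕜) := M.map (algebraMap 𝕜 (𝕜 →L[𝕜] 𝕜))
  have hNapply : ∀ p q x, N p q x = M p q * x := fun p q x => by
    simp [N, Algebra.algebraMap_eq_smul_one]
  have hN : N.PosSemidef := by
    have hiff := (RKHS.posSemidef_tfae (K := N)).out 0 2
    refine hiff.2 ⟨hM.1.map _ algebraMap_star_comm, fun z => ?_⟩
    convert (RCLike.nonneg_iff.1 (hM.2 z)).1 using 2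
    refine Finsupp.sum_congr fun p _ => Finsupp.sum_congr fun q _ => ?_
    rw [hNapply, RCLike.inner_apply, ← RCLike.star_def, star_mul', hM.1.apply, mul_comm,
      mul_comm (star _)]
  have : Fact N.PosSemidef := ⟨hN⟩
  let k : κ → RKHS.OfKernel N := fun p => RKHS.kerFun (RKHS.OfKernel N) p 1
  have hk : ∀ p q, inner 𝕜 (k p) (k q) = M p q := fun p q => by
    rw [← RKHS.kernel_inner, RKHS.OfKernel.kernel_ofKernel, hNapply, RCLike.inner_apply, one_mul,
      mul_one, ← RCLike.star_def, hM.1.apply]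
  have hdense : Dense (Submodule.span 𝕜 (Set.range k) : Set (RKHS.OfKernel N)) := by
    rw [Submodule.dense_iff_topologicalClosure_eq_top, eq_top_iff,
      ← RKHS.kerFun_dense (𝕜 := 𝕜) (RKHS.OfKernel N)]
    refine Submodule.topologicalClosure_mono (Submodule.span_le.2 ?_)
    rintro _ ⟨p, c, rfl⟩
    rw [← mul_one c, ← smul_eq_mul, map_smul]
    exact Submodule.smul_mem _ _ (Submodule.subset_span ⟨p, rfl⟩)
  obtain ⟨J⟩ := exists_linearIsometry_of_dense_span hdense he
  exact ⟨fun p => J (k p), fun p q => by rw [J.inner_map_map, hk]⟩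

/-! ### Extending Toeplitz functionals -/

theorem riesz_extension_comp {V W : Type*} [AddCommGroup V] [Module ℝ V] [AddCommGroup W]
    [Module ℝ W] (C : PointedCone ℝ V) (τ : W →ₗ[ℝ] V) (ℓ : W →ₗ[ℝ] ℝ)
    (hℓ : ∀ w, τ w ∈ C → 0 ≤ ℓ w) (hC : ∀ v, ∃ w, τ w + v ∈ C) :
    ∃ Φ : V →ₗ[ℝ] ℝ, Φ ∘ₗ τ = ℓ ∧ ∀ v ∈ C, 0 ≤ Φ v := by
  let S : PointedCone ℝ (W × V) := C.comap (τ.coprod LinearMap.id)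
  have hS : ∀ w v, (w, v) ∈ S ↔ τ w + v ∈ C := fun w v => Iff.rfl
  let f : W × V →ₗ.[ℝ] ℝ :=
    ⟨LinearMap.ker (LinearMap.snd ℝ W V), (ℓ ∘ₗ LinearMap.fst ℝ W V).domRestrict _⟩
  have hf : ∀ w, (w, 0) ∈ f.domain := fun w => rfl
  obtain ⟨g, hgf, hgS⟩ := riesz_extension S f
    (by
      rintro ⟨⟨w, v⟩, rfl : v = 0⟩ h
      exact hℓ w (by simpa using (hS w 0).1 h))
    (by
      rintro ⟨w, v⟩
      obtain ⟨w', hw'⟩ := hC v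
      exact ⟨⟨(w' - w, 0), hf _⟩, by simpa [hS] using hw'⟩)
  let Φ := g ∘ₗ LinearMap.inr ℝ W V
  have hΦ : ∀ w, ℓ w ≤ Φ (τ w) := fun w => by
    have hg0 : g (w, 0) = ℓ w := hgf ⟨(w, 0), hf w⟩
    rw [← sub_nonneg, ← hg0, LinearMap.comp_apply, LinearMap.inr_apply, ← map_sub]
    exact hgS _ ((hS _ _).2 (by simp))
  refine ⟨Φ, LinearMap.ext fun w => le_antisymm ?_ (hΦ w), fun v hv => ?_⟩
  · simpa using hΦ (-w)
  · exact hgS _ ((hS _ _).2 (by simpa using hv))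

theorem riesz_extension_comp_rclike {𝕜 V W : Type*} [RCLike 𝕜] [AddCommGroup V] [Module 𝕜 V]
    [Module ℝ V] [IsScalarTower ℝ 𝕜 V] [AddCommGroup W] [Module 𝕜 W] [Module ℝ W]
    [IsScalarTower ℝ 𝕜 W] (C : PointedCone ℝ V) (τ : W →ₗ[𝕜] V) (ℓ : W →ₗ[𝕜] 𝕜)
    (hℓ : ∀ w, τ w ∈ C → 0 ≤ RCLike.re (ℓ w)) (hC : ∀ v, ∃ w, τ w + v ∈ C) :
    ∃ Φ : V →ₗ[𝕜] 𝕜, Φ ∘ₗ τ = ℓ ∧ ∀ v ∈ C, 0 ≤ RCLike.re (Φ v) := by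
  obtain ⟨Φ, hΦ, hΦC⟩ := riesz_extension_comp C (τ.restrictScalars ℝ)
    (RCLike.reLm ∘ₗ ℓ.restrictScalars ℝ) hℓ hC
  refine ⟨Module.Dual.extendRCLike Φ, ?_, fun v hv => by simpa using hΦC v hv⟩
  refine Module.Dual.extendRCLikeₗ.symm.injective (LinearMap.ext fun w => ?_)
  simpa [Module.Dual.extendRCLikeₗ] using LinearMap.congr_fun hΦ w

/-- The evaluation `K ↦ ∑ p q, conj (z p) * K (p, q) * z q` of the sesquilinear form of a finitely
supported kernel `K` at a vector `z`, as a linear functional of `K`. As `K` has finite support, `z`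
may be arbitrary. -/
noncomputable def kernelForm {𝕜 κ : Type*} [RCLike 𝕜] (z : κ → 𝕜) : (κ × κ →₀ 𝕜) →ₗ[𝕜] 𝕜 :=
  Finsupp.linearCombination 𝕜 fun pq => star (z pq.1) * z pq.2

section

variable {𝕜 κ Ω : Type*} [RCLike 𝕜]

theorem kernelForm_single (z : κ → 𝕜) (p q : κ) (r : 𝕜) :
    kernelForm z (Finsupp.single (p, q) r) = r * (star (z p) * z q) := by
  simp [kernelForm]

theorem kernelForm_coe (z : κ →₀ 𝕜) (K : κ × κ →₀ 𝕜) :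
    kernelForm z K = z.sum fun p a => z.sum fun q b => star a * K (p, q) * b := by
  classical
  induction K using Finsupp.induction_linear with
  | zero => simp
  | add K L hK hL =>
    simp only [map_add, hK, hL, Finsupp.add_apply, mul_add, add_mul, Finsupp.sum_add]
  | single pq r =>
    obtain ⟨p, q⟩ := pq
    rw [kernelForm_single]
    have hrow : ∀ p' a, (z.sum fun q' b => star a * Finsupp.single (p, q) r (p', q') * b) =
        if p = p' then star a * r * z q else 0 := fun p' a => by
      simp only [Finsupp.single_apply, Prod.mk.injEq, ite_and, mul_ite, ite_mul, mul_zero, zero_mul]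
      split_ifs <;> simp +contextual
    simp only [hrow, Finsupp.sum_ite_eq, Finsupp.mem_support_iff, ite_not]
    split_ifs with h
    · simp [h]
    · ring

/-- The cone of finitely supported kernels on `κ` whose sesquilinear form has nonnegative real part.
The kernels are not required to be Hermitian, so that the cone absorbs `K - Kᴴ` for every `K` and a
functional that is nonnegative on it is automatically Hermitian. -/
noncomputable def posKernelCone (𝕜 κ : Type*) [RCLike 𝕜] : PointedCone ℝ (κ × κ →₀ 𝕜) :=
  ⨅ z : κ → 𝕜, (PointedCone.positive ℝ ℝ).comap (RCLike.reLm ∘ₗ (kernelForm z).restrictScalars ℝ)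

theorem mem_posKernelCone {K : κ × κ →₀ 𝕜} :
    K ∈ posKernelCone 𝕜 κ ↔ ∀ z, 0 ≤ RCLike.re (kernelForm z K) := by
  simp [posKernelCone, Submodule.mem_iInf]

theorem single_sub_single_swap_mem_posKernelCone (p q : κ) (r : 𝕜) :
    Finsupp.single (p, q) r - Finsupp.single (q, p) (star r) ∈ posKernelCone 𝕜 κ := by
  refine mem_posKernelCone.2 fun z => ?_
  rw [map_sub, kernelForm_single, kernelForm_single, map_sub, sub_nonneg, ← RCLike.conj_re]
  simp [mul_comm]

theorem sum_single_mem_posKernelCone (s : Finset κ) (x : κ → 𝕜) :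
    ∑ p ∈ s, ∑ q ∈ s, Finsupp.single (p, q) (star (x p) * x q) ∈ posKernelCone 𝕜 κ := by
  refine mem_posKernelCone.2 fun z => ?_
  have hsq : kernelForm z (∑ p ∈ s, ∑ q ∈ s, Finsupp.single (p, q) (star (x p) * x q)) =
      star (∑ p ∈ s, x p * z p) * ∑ p ∈ s, x p * z p := by
    simp only [map_sum, kernelForm_single, star_sum, star_mul', Finset.sum_mul_sum,
      mul_mul_mul_comm]
  rw [hsq]
  exact (RCLike.nonneg_iff.1 (star_mul_self_nonneg _)).1

/-- Composition `w ↦ w ∘ φ` of finitely supported functions with a map `φ` whose fibres are finite.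
With `φ` the index map of Toeplitz kernels, its range is the space of Toeplitz kernels. -/
noncomputable def finsuppPullback {α : Type*} (φ : α → Ω) (hφ : ∀ t, (φ ⁻¹' {t}).Finite) :
    (Ω →₀ 𝕜) →ₗ[𝕜] (α →₀ 𝕜) where
  toFun w := Finsupp.ofSupportFinite (fun a => w (φ a)) <|
    (w.hasFiniteSupport.preimage' fun t _ => hφ t : (φ ⁻¹' Function.support w).Finite)
  map_add' _ _ := by ext; rfl
  map_smul' _ _ := by ext; rfl

theorem finsuppPullback_apply {α : Type*} {φ : α → Ω} (hφ : ∀ t, (φ ⁻¹' {t}).Finite) (w : Ω →₀ 𝕜)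
    (a : α) : finsuppPullback φ hφ w a = w (φ a) := rfl

theorem finsuppPullback_single {α : Type*} {φ : α → Ω} (hφ : ∀ t, (φ ⁻¹' {t}).Finite) (t : Ω)
    (r : 𝕜) : finsuppPullback φ hφ (Finsupp.single t r) =
      ∑ a ∈ (hφ t).toFinset, Finsupp.single a r := by
  classical
  ext a
  simp [finsuppPullback_apply, Finsupp.single_apply, Finsupp.finsetSum_apply, eq_comm]

theorem le_re_kernelForm_finsuppPullback_single {φ : κ × κ → Ω} (hφ : ∀ t, (φ ⁻¹' {t}).Finite)
    (hdiag : ∀ p q s, φ (p, q) = φ (s, s) → p = q) (p : κ) {c : ℝ} (hc : 0 ≤ c) (z : κ → 𝕜) :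
    c * ‖z p‖ ^ 2 ≤
      RCLike.re (kernelForm z (finsuppPullback φ hφ (Finsupp.single (φ (p, p)) (c : 𝕜)))) := by
  have hterm : ∀ s : κ, RCLike.re (kernelForm z (Finsupp.single (s, s) (c : 𝕜))) = c * ‖z s‖ ^ 2 :=
    fun s => by
      rw [kernelForm_single, RCLike.star_def, RCLike.conj_mul]
      norm_cast
  rw [finsuppPullback_single, map_sum, map_sum, ← hterm]
  refine Finset.single_le_sum (f := fun pq => RCLike.re (kernelForm z (Finsupp.single pq (c : 𝕜))))
    ?_ (a := (p, p)) (by simp)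
  rintro ⟨q, q'⟩ hq
  obtain rfl : q = q' := hdiag q q' p (by simpa using hq)
  rw [hterm]
  positivity

theorem exists_finsuppPullback_add_mem_posKernelCone {φ : κ × κ → Ω}
    (hφ : ∀ t, (φ ⁻¹' {t}).Finite) (hdiag : ∀ p q s, φ (p, q) = φ (s, s) → p = q)
    (v : κ × κ →₀ 𝕜) : ∃ w : Ω →₀ 𝕜, finsuppPullback φ hφ w + v ∈ posKernelCone 𝕜 κ := by
  induction v using Finsupp.induction_linear with
  | zero => exact ⟨0, by simp⟩
  | add v v' hv hv' =>
    obtain ⟨w, hw⟩ := hv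
    obtain ⟨w', hw'⟩ := hv'
    exact ⟨w + w', by simpa only [map_add, add_add_add_comm] using add_mem hw hw'⟩
  | single pq r =>
    obtain ⟨p, q⟩ := pq
    refine ⟨.single (φ (p, p)) (‖r‖ : 𝕜) + .single (φ (q, q)) (‖r‖ : 𝕜),
      mem_posKernelCone.2 fun z => ?_⟩
    have hp := le_re_kernelForm_finsuppPullback_single hφ hdiag p (norm_nonneg r) z
    have hq := le_re_kernelForm_finsuppPullback_single hφ hdiag q (norm_nonneg r) z
    have hr : -(‖r‖ * (‖z p‖ * ‖z q‖)) ≤ RCLike.re (kernelForm z (.single (p, q) r)) := by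
      rw [kernelForm_single]
      refine neg_le_of_abs_le ((RCLike.abs_re_le_norm _).trans_eq ?_)
      rw [norm_mul, norm_mul, norm_star]
    simp only [map_add]
    nlinarith [mul_nonneg (norm_nonneg r) (sq_nonneg (‖z p‖ - ‖z q‖)),
      mul_nonneg (norm_nonneg r) (sq_nonneg (‖z p‖ + ‖z q‖))]

theorem posSemidef_add_conjTranspose {M : Matrix κ κ 𝕜}
    (h : ∀ z : κ →₀ 𝕜, 0 ≤ RCLike.re (z.sum fun p a => z.sum fun q b => star a * M p q * b)) :
    (M + M.conjTranspose).PosSemidef := by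
  refine posSemidef_of_re_nonneg (Matrix.isHermitian_add_transpose_self M) fun z => ?_
  have hconj : (z.sum fun p a => z.sum fun q b => star a * M.conjTranspose p q * b) =
      star (z.sum fun p a => z.sum fun q b => star a * M p q * b) := by
    rw [Finsupp.sum_comm]
    simp [Finsupp.sum, mul_left_comm, mul_comm]
  simp only [Matrix.add_apply, mul_add, add_mul, Finsupp.sum_add]
  rw [hconj, map_add, RCLike.star_def, RCLike.conj_re]
  exact add_nonneg (h z) (h z)

theorem posSemidef_of_nonneg_on_posKernelCone {Φ : (κ × κ →₀ 𝕜) →ₗ[𝕜] 𝕜}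
    (hΦ : ∀ K ∈ posKernelCone 𝕜 κ, 0 ≤ RCLike.re (Φ K)) :
    (Matrix.of fun p q => Φ (.single (p, q) 1)).PosSemidef := by
  have hsmul : ∀ p q r, Φ (.single (p, q) r) = r * Φ (.single (p, q) 1) := fun p q r => by
    rw [← smul_eq_mul, ← map_smul, Finsupp.smul_single_one]
  have hswap : ∀ p q r,
      RCLike.re (Φ (.single (q, p) (star r))) = RCLike.re (Φ (.single (p, q) r)) := by
    intro p q r
    have h1 := hΦ _ (single_sub_single_swap_mem_posKernelCone p q r)
    have h2 := hΦ _ (single_sub_single_swap_mem_posKernelCone q p (star r))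
    rw [map_sub, map_sub, sub_nonneg] at h1 h2
    exact le_antisymm h1 (by rwa [star_star] at h2)
  refine posSemidef_of_re_nonneg ?_ fun z => ?_
  · ext p q
    let δ := star (Φ (.single (q, p) 1)) - Φ (.single (p, q) 1)
    have hδ : RCLike.re (star δ * δ) = 0 := by
      have h := hswap p q (star δ)
      rw [star_star, hsmul, ← RCLike.conj_re, map_mul, hsmul p] at h
      rw [mul_sub, map_sub, sub_eq_zero]
      exact h
    rw [RCLike.star_def, RCLike.conj_mul] at hδ
    norm_cast at hδ
    exact sub_eq_zero.1 (norm_eq_zero.1 (pow_eq_zero_iff two_ne_zero |>.1 hδ))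
  · refine (hΦ _ (sum_single_mem_posKernelCone z.support z)).trans_eq (congrArg _ ?_)
    simp only [map_sum]
    refine Finset.sum_congr rfl fun p _ => Finset.sum_congr rfl fun q _ => ?_
    exact (hsmul p q _).trans (mul_right_comm _ _ _)

theorem exists_posSemidef_fiber_sum_eq {φ : κ × κ → Ω} (hφ : ∀ t, (φ ⁻¹' {t}).Finite)
    (hdiag : ∀ p q s, φ (p, q) = φ (s, s) → p = q) (c : Ω → 𝕜)
    (hc : ∀ w : Ω →₀ 𝕜, (Matrix.of fun p q => w (φ (p, q)) + star (w (φ (q, p)))).PosSemidef →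
      0 ≤ RCLike.re (w.sum fun t r => r * c t)) :
    ∃ T : Matrix κ κ 𝕜, T.PosSemidef ∧ ∀ t, ∑ pq ∈ (hφ t).toFinset, T pq.1 pq.2 = c t := by
  obtain ⟨Φ, hΦτ, hΦ⟩ := riesz_extension_comp_rclike (posKernelCone 𝕜 κ) (finsuppPullback φ hφ)
    (Finsupp.linearCombination 𝕜 c)
    (fun w hw => hc w <| posSemidef_add_conjTranspose (M := Matrix.of fun p q => w (φ (p, q)))
      fun z => (mem_posKernelCone.1 hw z).trans_eq (congrArg _ (kernelForm_coe z _)))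
    (exists_finsuppPullback_add_mem_posKernelCone hφ hdiag)
  refine ⟨_, posSemidef_of_nonneg_on_posKernelCone hΦ, fun t => ?_⟩
  have h := LinearMap.congr_fun hΦτ (.single t 1)
  rw [LinearMap.comp_apply, finsuppPullback_single, map_sum] at h
  simpa using h

end

/-! ### Representations of the free group -/

theorem exists_unitary_of_inner_eq {𝕜 V ι : Type*} [RCLike 𝕜] [NormedAddCommGroup V]
    [InnerProductSpace 𝕜 V] [FiniteDimensional 𝕜 V] [CompleteSpace V] {v w : ι → V}
    (h : ∀ i j, inner 𝕜 (v i) (v j) = inner 𝕜 (w i) (w j)) :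
    ∃ U : unitary (V →L[𝕜] V), ∀ i, (U : V →L[𝕜] V) (v i) = w i := by
  let A := (Finsupp.linearCombination 𝕜 v).rangeRestrict
  let B := Finsupp.linearCombination 𝕜 w
  have hA : DenseRange A := (LinearMap.surjective_rangeRestrict _).denseRange
  have hnorm : ∀ c, ‖B c‖ = ‖A c‖ := fun c => by
    have hinner : inner 𝕜 (B c) (B c) = inner 𝕜 (A c) (A c) := by
      simp only [A, B, Submodule.coe_inner, LinearMap.rangeRestrict, LinearMap.codRestrict_apply,
        Finsupp.linearCombination_apply, Finsupp.sum, sum_inner, inner_sum, inner_smul_left,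
        inner_smul_right, h]
    rw [@norm_eq_sqrt_re_inner 𝕜, hinner, ← @norm_eq_sqrt_re_inner 𝕜]
  have hT : ∀ c, B.extendOfNorm A (A c) = B c :=
    LinearMap.extendOfNorm_eq hA ⟨1, fun c => by rw [one_mul, hnorm]⟩
  let T : LinearMap.range (Finsupp.linearCombination 𝕜 v) →ₗᵢ[𝕜] V :=
    ⟨B.extendOfNorm A, (LinearMap.surjective_rangeRestrict _).forall.2 fun c =>
      (congrArg norm (hT c)).trans (hnorm c)⟩
  refine ⟨Unitary.linearIsometryEquiv.symm (T.extend.toLinearIsometryEquiv rfl), fun i => ?_⟩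
  have hv : (A (.single i 1) : V) = v i := by simp [A]
  have hw : B (.single i 1) = w i := by simp [B]
  rw [← hv, ← hw, ← hT]
  exact T.extend_apply _

theorem IsGrounded.induction {d : ℕ} {E : Set (FreeGroup (Fin d))} (hE : IsGrounded E)
    {p : FreeGroup (Fin d) → Prop} (one : p 1)
    (of_mul : ∀ l, ∀ x ∈ E, .of l * x ∈ E → (p x ↔ p (.of l * x))) {x : FreeGroup (Fin d)}
    (hx : x ∈ E) : p x := by
  suffices h : ∀ y : E, ((freeCayleyGraph d).induce E).Reachable ⟨1, hE.1⟩ y → p y from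
    h ⟨x, hx⟩ (hE.2.preconnected _ _)
  intro y hy
  rw [SimpleGraph.reachable_iff_reflTransGen] at hy
  induction hy with
  | refl => exact one
  | @tail y z _ hadj ih =>
    obtain ⟨l, h | h⟩ := SimpleGraph.induce_adj.1 hadj
    · have hlz : .of l * (z : FreeGroup (Fin d)) = y := by rw [← h, inv_mul_cancel_right]
      exact (of_mul l z z.2 (hlz ▸ y.2)).2 (hlz ▸ ih)
    · have hly : .of l * (y : FreeGroup (Fin d)) = z := by
        rw [mul_inv_eq_iff_eq_mul.1 h, mul_inv_cancel_left]
      exact hly ▸ (of_mul l y y.2 (hly ▸ z.2)).1 ih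

theorem IsGrounded.exists_finset {d : ℕ} {E : Set (FreeGroup (Fin d))} (hE : IsGrounded E)
    {B : Finset (FreeGroup (Fin d))} (hB : (B : Set (FreeGroup (Fin d))) ⊆ E) :
    ∃ F : Finset (FreeGroup (Fin d)), IsGrounded (F : Set (FreeGroup (Fin d))) ∧ B ⊆ F ∧
      (F : Set (FreeGroup (Fin d))) ⊆ E := by
  classical
  obtain ⟨F, hBF, hF⟩ := SimpleGraph.extend_finset_to_connected hE.2.preconnected
    (t := insert ⟨1, hE.1⟩ (B.subtype (· ∈ E))) (Finset.insert_nonempty _ _)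
  have hmem : ∀ x (hx : x ∈ E), ⟨x, hx⟩ ∈ F → x ∈ F.map (.subtype (· ∈ E)) := fun x hx hxF =>
    Finset.mem_map.2 ⟨⟨x, hx⟩, hxF, rfl⟩
  refine ⟨F.map (.subtype (· ∈ E)), ⟨hmem 1 hE.1 (hBF (Finset.mem_insert_self _ _)), ?_⟩,
    fun x hx => hmem x (hB hx) (hBF (by simp [hx])), Finset.map_subtype_subset F⟩
  let incl : ((freeCayleyGraph d).induce E).induce (F : Set E) →g
      (freeCayleyGraph d).induce (F.map (.subtype (· ∈ E)) : Set (FreeGroup (Fin d))) :=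
    ⟨fun x => ⟨x.1.1, hmem _ x.1.2 x.2⟩, id⟩
  refine hF.map incl fun ⟨y, hy⟩ => ?_
  obtain ⟨x, hx, rfl⟩ := Finset.mem_map.1 hy
  exact ⟨⟨x, hx⟩, rfl⟩

theorem isGrounded_univ (d : ℕ) : IsGrounded (Set.univ : Set (FreeGroup (Fin d))) := by
  have hreach : ∀ x y : FreeGroup (Fin d), (freeCayleyGraph d).Reachable y (x * y) := by
    intro x
    induction x using FreeGroup.induction_on with
    | C1 => simp
    | of l => exact fun y => SimpleGraph.Adj.reachable ⟨l, Or.inr (by simp)⟩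
    | inv_of l _ => exact fun y => SimpleGraph.Adj.reachable ⟨l, Or.inl (by simp)⟩
    | mul a b ha hb => exact fun y => mul_assoc a b y ▸ (hb y).trans (ha (b * y))
  refine ⟨Set.mem_univ _, (SimpleGraph.induceUnivIso _).connected_iff.2 ⟨fun x y => ?_⟩⟩
  simpa using hreach (y * x⁻¹) x

theorem IsGrounded.exists_rep {𝕜 V ι : Type*} [RCLike 𝕜] [NormedAddCommGroup V]
    [InnerProductSpace 𝕜 V] [FiniteDimensional 𝕜 V] [CompleteSpace V] {d : ℕ}
    {E : Set (FreeGroup (Fin d))} (hE : IsGrounded E) (g : FreeGroup (Fin d) → ι → V)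
    (hg : ∀ x ∈ E, ∀ y ∈ E, ∀ x' ∈ E, ∀ y' ∈ E, x⁻¹ * y = x'⁻¹ * y' →
      ∀ i j, inner 𝕜 (g x i) (g y j) = inner 𝕜 (g x' i) (g y' j)) :
    ∃ π : FreeGroup (Fin d) →* unitary (V →L[𝕜] V),
      ∀ x ∈ E, ∀ i, (π x : V →L[𝕜] V) (g 1 i) = g x i := by
  have hU : ∀ l : Fin d, ∃ U : unitary (V →L[𝕜] V), ∀ x ∈ E, .of l * x ∈ E →
      ∀ i, (U : V →L[𝕜] V) (g x i) = g (.of l * x) i := by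
    intro l
    obtain ⟨U, hU⟩ := exists_unitary_of_inner_eq (𝕜 := 𝕜)
      (v := fun t : {x // x ∈ E ∧ .of l * x ∈ E} × ι => g t.1 t.2)
      (w := fun t => g (.of l * t.1) t.2) fun s t =>
        hg _ s.1.2.1 _ t.1.2.1 _ s.1.2.2 _ t.1.2.2 (by group) _ _
    exact ⟨U, fun x hx hx' i => hU (⟨x, hx, hx'⟩, i)⟩
  choose U hU using hU
  refine ⟨FreeGroup.lift U, fun x hx => hE.induction
    (p := fun x => ∀ i, (FreeGroup.lift U x : V →L[𝕜] V) (g 1 i) = g x i) ?_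
    (fun l x hx hlx => forall_congr' fun i => ?_) hx⟩
  · simp
  · have hinj : Function.Injective (U l : V →L[𝕜] V) :=
      (Unitary.linearIsometryEquiv (U l)).injective
    rw [map_mul, FreeGroup.lift_apply_of, ← hU l x hx hlx, Submonoid.coe_mul, mul_apply_eq_comp,
      hinj.eq_iff]

theorem IsGrounded.exists_rep_of_posSemidef {𝕜 V ι : Type*} [RCLike 𝕜] [NormedAddCommGroup V]
    [InnerProductSpace 𝕜 V] [FiniteDimensional 𝕜 V] [CompleteSpace V] {d : ℕ}
    {E : Set (FreeGroup (Fin d))} (hE : IsGrounded E) {e : E × ι → V} (he : Orthonormal 𝕜 e)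
    {N : FreeGroup (Fin d) → ι → ι → 𝕜}
    (hN : (Matrix.of fun p q : E × ι =>
      N ((p.1 : FreeGroup (Fin d))⁻¹ * q.1) p.2 q.2).PosSemidef) :
    ∃ (π : FreeGroup (Fin d) →* unitary (V →L[𝕜] V)) (u : ι → V), ∀ x ∈ E, ∀ y ∈ E, ∀ i j,
      inner 𝕜 (u i) ((π (x⁻¹ * y) : V →L[𝕜] V) (u j)) = N (x⁻¹ * y) i j := by
  classical
  obtain ⟨u, hu⟩ := exists_inner_eq_of_posSemidef he hN
  let g : FreeGroup (Fin d) → ι → V := fun x i => if hx : x ∈ E then u (⟨x, hx⟩, i) else 0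
  have hg : ∀ x ∈ E, ∀ y ∈ E, ∀ i j, inner 𝕜 (g x i) (g y j) = N (x⁻¹ * y) i j :=
    fun x hx y hy i j => by simp only [g, dif_pos hx, dif_pos hy, hu, Matrix.of_apply]
  obtain ⟨π, hπ⟩ := hE.exists_rep g fun x hx y hy x' hx' y' hy' h i j => by
    rw [hg x hx y hy, hg x' hx' y' hy', h]
  refine ⟨π, g 1, fun x hx y hy i j => ?_⟩
  rw [← hg x hx y hy, ← hπ x hx, ← hπ y hy, map_mul, map_inv, ← Unitary.star_eq_inv,
    Submonoid.coe_mul, Unitary.coe_star, mul_apply_eq_comp, ContinuousLinearMap.star_eq_adjoint,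
    ContinuousLinearMap.adjoint_inner_right]

/-! ### Evaluation at unitary representations -/

section

variable {𝕜 G H K : Type*} [RCLike 𝕜] [Group G] [NormedAddCommGroup H] [InnerProductSpace 𝕜 H]
  [NormedAddCommGroup K] [InnerProductSpace 𝕜 K] [CompleteSpace K] (π : G →* unitary (K →L[𝕜] K))

/-- The map `f ↦ (id ⊗ π)(f)` as a homomorphism of algebras. -/
noncomputable def evalRepAlgHom :
    MonoidAlgebra (H →L[𝕜] H) G →ₐ[𝕜] Module.End 𝕜 (H ⊗[𝕜] K) :=
  MonoidAlgebra.liftNCAlgHom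
    ((Module.End.rTensorAlgHom 𝕜 H K).comp
      (.ofLinearMap (ContinuousLinearMap.coeLM 𝕜) rfl fun _ _ => rfl))
    (((Module.End.lTensorAlgHom 𝕜 K H : Module.End 𝕜 K →* Module.End 𝕜 (H ⊗[𝕜] K)).comp
      (ContinuousLinearMap.toLinearMapRingHom (R₁ := 𝕜) (M₁ := K)).toMonoidHom).comp
        ((unitary (K →L[𝕜] K)).subtype.comp π))
    fun _ _ => (LinearMap.rTensor_comp_lTensor _ _ _).trans
      (LinearMap.lTensor_comp_rTensor _ _ _).symm

theorem evalRepAlgHom_apply (f : MonoidAlgebra (H →L[𝕜] H) G) :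
    evalRepAlgHom π f = evalRep π f :=
  Finset.sum_congr rfl fun _ _ => LinearMap.rTensor_comp_lTensor _ _ _

theorem evalRepAlgHom_single (a : G) (A : H →L[𝕜] H) :
    evalRepAlgHom π (.single a A) =
      TensorProduct.map (A : H →ₗ[𝕜] H) ((π a : K →L[𝕜] K) : K →ₗ[𝕜] K) :=
  (MonoidAlgebra.liftNC_single _ _ _ _).trans (LinearMap.rTensor_comp_lTensor _ _ _)

theorem inner_evalRep_sum_tmul {ι : Type*} [Fintype ι] (f : MonoidAlgebra (H →L[𝕜] H) G)
    (e : ι → H) (u : ι → K) :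
    inner 𝕜 (∑ i, e i ⊗ₜ[𝕜] u i) (evalRep π f (∑ i, e i ⊗ₜ[𝕜] u i)) =
      ∑ a ∈ f.coeff.support, ∑ i, ∑ j,
        inner 𝕜 (e i) (f.coeff a (e j)) * inner 𝕜 (u i) ((π a : K →L[𝕜] K) (u j)) := by
  simp only [evalRep, LinearMap.sum_apply, map_sum, TensorProduct.map_tmul, inner_sum, sum_inner,
    TensorProduct.inner_tmul, ContinuousLinearMap.coe_coe]
  rw [Finset.sum_comm]
  exact Finset.sum_congr rfl fun a _ => Finset.sum_comm

variable [CompleteSpace H]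

theorem inner_evalRep_star_left (f : MonoidAlgebra (H →L[𝕜] H) G) (s t : H ⊗[𝕜] K) :
    inner 𝕜 (evalRep π (star f) s) t = inner 𝕜 s (evalRep π f t) := by
  simp only [← evalRepAlgHom_apply]
  induction f using MonoidAlgebra.induction_linear with
  | zero => simp only [star_zero, map_zero, LinearMap.zero_apply, inner_zero_left, inner_zero_right]
  | add f g hf hg => simp only [star_add, map_add, LinearMap.add_apply, inner_add_left,
      inner_add_right, hf, hg]
  | single a A =>
    rw [groupAlgebra_star_single, evalRepAlgHom_single, evalRepAlgHom_single, map_inv,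
      ← Unitary.star_eq_inv, Unitary.coe_star, ContinuousLinearMap.star_eq_adjoint,
      ContinuousLinearMap.star_eq_adjoint]
    induction s using TensorProduct.induction_on with
    | zero => simp only [map_zero, inner_zero_left]
    | add s₁ s₂ h₁ h₂ => rw [map_add, inner_add_left, inner_add_left, h₁, h₂]
    | tmul h u =>
      induction t using TensorProduct.induction_on with
      | zero => simp only [map_zero, inner_zero_right]
      | add t₁ t₂ h₁ h₂ => rw [map_add, inner_add_right, inner_add_right, h₁, h₂]
      | tmul h' u' =>
        simp only [TensorProduct.map_tmul, TensorProduct.inner_tmul, ContinuousLinearMap.coe_coe,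
          ContinuousLinearMap.adjoint_inner_left]

theorem isPositive_evalRep_star_mul_self (f : MonoidAlgebra (H →L[𝕜] H) G) :
    (evalRep π (star f * f)).IsPositive := by
  refine ⟨fun s t => ?_, fun t => ?_⟩
  · rw [← inner_evalRep_star_left, (IsSelfAdjoint.star_mul_self f).star_eq]
  · rw [← evalRepAlgHom_apply, map_mul, Module.End.mul_apply, evalRepAlgHom_apply,
      evalRepAlgHom_apply, inner_evalRep_star_left]
    exact inner_self_nonneg

theorem isPositive_evalRep_of_mem_sosCone {f : MonoidAlgebra (H →L[𝕜] H) G}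
    (hf : f ∈ sosCone (MonoidAlgebra (H →L[𝕜] H) G)) : (evalRep π f).IsPositive := by
  obtain ⟨n, ξ, rfl⟩ := hf
  rw [← evalRepAlgHom_apply, map_sum]
  simp only [evalRepAlgHom_apply]
  exact LinearMap.isPositive_sum _ fun i _ => isPositive_evalRep_star_mul_self π (ξ i)

theorem isPositive_evalRep_of_mem_archClosure {f : MonoidAlgebra (H →L[𝕜] H) G}
    (hf : f ∈ archClosure 𝕜 (sosCone (MonoidAlgebra (H →L[𝕜] H) G))) :
    (evalRep π f).IsPositive := by
  refine ⟨fun s t => ?_, fun t => ?_⟩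
  · rw [← inner_evalRep_star_left, hf.1.star_eq]
  have hε : ∀ ε : ℝ, 0 < ε → 0 ≤ RCLike.re (inner 𝕜 (evalRep π f t) t) + ε * ‖t‖ ^ 2 := by
    intro ε hε
    have h := (isPositive_evalRep_of_mem_sosCone π (hf.2 ε hε)).2 t
    rwa [← evalRepAlgHom_apply, map_add, map_smul, map_one, evalRepAlgHom_apply,
      LinearMap.add_apply, LinearMap.smul_apply, Module.End.one_apply, inner_add_left, map_add,
      inner_smul_left, RCLike.conj_ofReal, RCLike.re_ofReal_mul, inner_self_eq_norm_sq] at h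
  have hlim : Filter.Tendsto (fun ε : ℝ => RCLike.re (inner 𝕜 (evalRep π f t) t) + ε * ‖t‖ ^ 2)
      (nhdsWithin 0 (Set.Ioi 0)) (nhds (RCLike.re (inner 𝕜 (evalRep π f t) t) + 0 * ‖t‖ ^ 2)) :=
    (Continuous.tendsto (by fun_prop) 0).mono_left nhdsWithin_le_nhds
  rw [zero_mul, add_zero] at hlim
  exact ge_of_tendsto hlim (eventually_mem_nhdsWithin.mono hε)

end

theorem sosCone_subset_archClosure {𝕜 A : Type*} [RCLike 𝕜] [Semiring A] [StarRing A]
    [Algebra 𝕜 A] [StarModule 𝕜 A] : sosCone A ⊆ archClosure 𝕜 (sosCone A) := by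
  rintro _ ⟨n, ξ, rfl⟩
  refine ⟨?_, fun ε hε => ⟨n + 1, Fin.cons (((√ε : ℝ) : 𝕜) • 1) ξ, ?_⟩⟩
  · exact isSelfAdjoint_sum _ fun i _ => .star_mul_self _
  · have hsq : star ((√ε : ℝ) : 𝕜) * (√ε : ℝ) = (ε : ℝ) := by
      rw [RCLike.star_def, RCLike.conj_ofReal, ← RCLike.ofReal_mul, Real.mul_self_sqrt hε.le]
    simp only [Fin.sum_univ_succ, Fin.cons_zero, Fin.cons_succ, star_smul, star_one,
      smul_mul_smul_comm, one_mul, hsq, add_comm]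

theorem map_mem_sosCone {A B F : Type*} [Semiring A] [StarRing A] [Semiring B] [StarRing B]
    [FunLike F A B] [RingHomClass F A B] [StarHomClass F A B] (φ : F) {a : A} (ha : a ∈ sosCone A) :
    φ a ∈ sosCone B := by
  obtain ⟨n, ξ, rfl⟩ := ha
  exact ⟨n, fun i => φ (ξ i), by simp only [map_sum, map_mul, map_star]⟩

theorem map_mem_archClosure_sosCone {𝕜 A B F : Type*} [RCLike 𝕜] [Semiring A] [StarRing A]
    [Algebra 𝕜 A] [Semiring B] [StarRing B] [Algebra 𝕜 B] [FunLike F A B] [AlgHomClass F 𝕜 A B]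
    [StarHomClass F A B] (φ : F) {a : A} (ha : a ∈ archClosure 𝕜 (sosCone A)) :
    φ a ∈ archClosure 𝕜 (sosCone B) := by
  refine ⟨ha.1.map φ, fun ε hε => ?_⟩
  simpa only [map_add, map_smul, map_one] using map_mem_sosCone φ (ha.2 ε hε)

section

variable {𝕜 G : Type*} [RCLike 𝕜] [Group G]

instance : StarModule 𝕜 (MonoidAlgebra 𝕜 G) where
  star_smul r f := by
    ext
    simp [groupAlgebra_coeff_star]

/-- The identification of `𝕜[G]` with `𝔹(𝕜)[G]`, scalars acting on `𝕜` by multiplication. It makes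
the results on operator coefficients available for scalar coefficients. -/
noncomputable def scalarToOperator : MonoidAlgebra 𝕜 G ≃⋆ₐ[𝕜] MonoidAlgebra (𝕜 →L[𝕜] 𝕜) G :=
  .ofAlgEquiv (MonoidAlgebra.mapAlgEquiv 𝕜 G (.ofBijective (Algebra.ofId 𝕜 (𝕜 →L[𝕜] 𝕜))
    ⟨(algebraMap 𝕜 (𝕜 →L[𝕜] 𝕜)).injective, fun A => ⟨A 1, by
      ext; simp [Algebra.ofId_apply, Algebra.algebraMap_eq_smul_one]⟩⟩))
    fun f => MonoidAlgebra.ext <| Finsupp.ext fun s => by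
      rw [groupAlgebra_coeff_star]
      exact (congrArg _ (groupAlgebra_coeff_star f s)).trans
        (algebraMap_star_comm (A := 𝕜 →L[𝕜] 𝕜) (f.coeff s⁻¹))

end

/-! ### Sums of squares -/

theorem IsGrounded.re_sum_inner_mul_nonneg {𝕜 H I : Type*} [RCLike 𝕜] [NormedAddCommGroup H]
    [InnerProductSpace 𝕜 H] {d : ℕ} {f : MonoidAlgebra (H →L[𝕜] H) (FreeGroup (Fin d))}
    {E : Finset (FreeGroup (Fin d))} (hE : IsGrounded (E : Set (FreeGroup (Fin d))))
    (hfE : (f.coeff.support : Set (FreeGroup (Fin d))) ⊆ (E : Set (FreeGroup (Fin d)))⁻¹ * E)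
    (s : Finset I) (hpos : ∀ π : FreeGroup (Fin d) →*
      unitary (EuclideanSpace 𝕜 (Fin (E.card * s.card)) →L[𝕜]
        EuclideanSpace 𝕜 (Fin (E.card * s.card))), (evalRep π f).IsPositive)
    (e : I → H) {N : FreeGroup (Fin d) × I × I → 𝕜}
    (hN : (Matrix.of fun p q : E × I =>
      N ((p.1 : FreeGroup (Fin d))⁻¹ * q.1, p.2, q.2)).PosSemidef) :
    0 ≤ RCLike.re (∑ t ∈ f.coeff.support ×ˢ s ×ˢ s,
      N t * inner 𝕜 (e t.2.1) (f.coeff t.1 (e t.2.2))) := by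
  let ε : E × s ≃ Fin (E.card * s.card) := Fintype.equivFinOfCardEq (by simp)
  obtain ⟨π, u, hu⟩ := hE.exists_rep_of_posSemidef (N := fun a (i j : s) => N (a, i, j))
    ((EuclideanSpace.basisFun _ 𝕜).orthonormal.comp ε ε.injective)
    (hN.submatrix (Prod.map id ((↑) : s → I)))
  have h := (hpos π).re_inner_nonneg_right (∑ i : s, e i ⊗ₜ[𝕜] u i)
  rw [inner_evalRep_sum_tmul] at h
  refine h.trans_eq (congrArg _ ?_)
  rw [Finset.sum_product]
  refine Finset.sum_congr rfl fun a ha => ?_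
  obtain ⟨x, hx, y, hy, rfl⟩ := Set.mem_mul.1 (hfE ha)
  rw [Finset.sum_product, ← Finset.sum_coe_sort s]
  refine Finset.sum_congr rfl fun i _ => ?_
  rw [← Finset.sum_coe_sort s]
  refine Finset.sum_congr rfl fun j _ => ?_
  have hπ := hu x⁻¹ hx y hy i j
  rw [inv_inv] at hπ
  rw [hπ, mul_comm]

theorem groupAlgebra_coeff_inv {R G : Type*} [Semiring R] [StarRing R] [Group G]
    {f : MonoidAlgebra R G} (hf : IsSelfAdjoint f) (a : G) : f.coeff a⁻¹ = star (f.coeff a) := by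
  conv_lhs => rw [← hf.star_eq, groupAlgebra_coeff_star, inv_inv]

theorem sum_star_swap_mul_inner {𝕜 G H I : Type*} [RCLike 𝕜] [Group G] [NormedAddCommGroup H]
    [InnerProductSpace 𝕜 H] [CompleteSpace H] {f : MonoidAlgebra (H →L[𝕜] H) G}
    (hf : IsSelfAdjoint f) (s : Finset I) (e : I → H) (w : G × I × I → 𝕜) :
    ∑ t ∈ f.coeff.support ×ˢ s ×ˢ s,
        star (w (t.1⁻¹, t.2.2, t.2.1)) * inner 𝕜 (e t.2.1) (f.coeff t.1 (e t.2.2)) =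
      star (∑ t ∈ f.coeff.support ×ˢ s ×ˢ s,
        w t * inner 𝕜 (e t.2.1) (f.coeff t.1 (e t.2.2))) := by
  rw [star_sum]
  refine Finset.sum_nbij' (fun t => (t.1⁻¹, t.2.2, t.2.1)) (fun t => (t.1⁻¹, t.2.2, t.2.1))
    ?_ ?_ ?_ ?_ ?_
  · simp +contextual [groupAlgebra_coeff_inv hf]
  · simp +contextual [groupAlgebra_coeff_inv hf]
  · simp
  · simp
  · rintro ⟨a, i, j⟩ -
    rw [groupAlgebra_coeff_inv hf, star_mul', ContinuousLinearMap.star_eq_adjoint,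
      ContinuousLinearMap.adjoint_inner_right, RCLike.star_def, inner_conj_symm]

theorem IsGrounded.re_finsuppSum_inner_nonneg {𝕜 H I : Type*} [RCLike 𝕜] [NormedAddCommGroup H]
    [InnerProductSpace 𝕜 H] [CompleteSpace H] {d : ℕ}
    {f : MonoidAlgebra (H →L[𝕜] H) (FreeGroup (Fin d))} (hf : IsSelfAdjoint f)
    {E : Finset (FreeGroup (Fin d))} (hE : IsGrounded (E : Set (FreeGroup (Fin d))))
    (hfE : (f.coeff.support : Set (FreeGroup (Fin d))) ⊆ (E : Set (FreeGroup (Fin d)))⁻¹ * E)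
    {e : I → H} (he : LinearIndependent 𝕜 e)
    (hpos : ∀ (m : ℕ) (π : FreeGroup (Fin d) →*
        unitary (EuclideanSpace 𝕜 (Fin m) →L[𝕜] EuclideanSpace 𝕜 (Fin m))),
      (m : ℕ∞) ≤ E.card * Cardinal.toENat (Module.rank 𝕜 H) → (evalRep π f).IsPositive)
    {w : FreeGroup (Fin d) × I × I →₀ 𝕜}
    (hw : (Matrix.of fun p q : E × I => w ((p.1 : FreeGroup (Fin d))⁻¹ * q.1, p.2, q.2) +
      star (w ((q.1 : FreeGroup (Fin d))⁻¹ * p.1, q.2, p.2))).PosSemidef) :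
    0 ≤ RCLike.re (w.sum fun t r => r * inner 𝕜 (e t.2.1) (f.coeff t.1 (e t.2.2))) := by
  classical
  let s : Finset I := w.support.image (fun t => t.2.1) ∪ w.support.image (fun t => t.2.2)
  have hs : ∀ t ∈ w.support, t.2.1 ∈ s ∧ t.2.2 ∈ s := fun t ht =>
    ⟨Finset.mem_union_left _ (Finset.mem_image_of_mem _ ht),
      Finset.mem_union_right _ (Finset.mem_image_of_mem _ ht)⟩
  have hrank : (s.card : ℕ∞) ≤ Cardinal.toENat (Module.rank 𝕜 H) := by
    rw [← Cardinal.toENat_nat]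
    refine Cardinal.toENat.monotone' ?_
    simpa using (he.comp ((↑) : s → I) Subtype.val_injective).cardinal_lift_le_rank
  have hsum : (w.sum fun t r => r * inner 𝕜 (e t.2.1) (f.coeff t.1 (e t.2.2))) =
      ∑ t ∈ f.coeff.support ×ˢ s ×ˢ s, w t * inner 𝕜 (e t.2.1) (f.coeff t.1 (e t.2.2)) := by
    refine Finset.sum_congr_of_eq_on_inter (fun t ht htP => ?_) (fun t _ ht => ?_)
      fun _ _ _ => rfl
    · have hft : f.coeff t.1 = 0 := by simpa [hs t ht] using htP
      simp only [hft, zero_apply, inner_zero_right, mul_zero]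
    · rw [Finsupp.notMem_support_iff.1 ht, zero_mul]
  have h := hE.re_sum_inner_mul_nonneg hfE s
    (fun π => hpos _ π (by rw [Nat.cast_mul]; gcongr)) e
    (N := fun t => w t + star (w (t.1⁻¹, t.2.2, t.2.1))) (by simpa [mul_inv_rev] using hw)
  simp only [add_mul, Finset.sum_add_distrib, sum_star_swap_mul_inner hf] at h
  rw [map_add, RCLike.star_def, RCLike.conj_re, ← hsum] at h
  linarith

theorem exists_continuousLinearMap_apply_hilbertBasis {𝕜 H L I ι : Type*} [RCLike 𝕜]
    [NormedAddCommGroup H] [InnerProductSpace 𝕜 H] [NormedAddCommGroup L] [InnerProductSpace 𝕜 L]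
    [CompleteSpace L] [Fintype ι] (b : HilbertBasis I 𝕜 H) {v : ι → I → L} {A : H →L[𝕜] H}
    (hA : ∀ i j, ∑ x, inner 𝕜 (v x i) (v x j) = inner 𝕜 (b i) (A (b j))) :
    ∃ V : ι → H →L[𝕜] L, ∀ x i, V x (b i) = v x i := by
  let β := Finsupp.linearCombination 𝕜 b
  have hdense : DenseRange β := by
    rw [DenseRange, ← LinearMap.coe_range, Finsupp.range_linearCombination,
      Submodule.dense_iff_topologicalClosure_eq_top, b.dense_span]
  have hsum : ∀ c, ∑ x, inner 𝕜 (Finsupp.linearCombination 𝕜 (v x) c)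
      (Finsupp.linearCombination 𝕜 (v x) c) = inner 𝕜 (β c) (A (β c)) := fun c => by
    simp only [β, Finsupp.linearCombination_apply, Finsupp.sum, map_sum, map_smul, sum_inner,
      inner_sum, inner_smul_left, inner_smul_right, ← hA, Finset.mul_sum]
    rw [Finset.sum_comm]
    refine Finset.sum_congr rfl fun i _ => ?_
    rw [Finset.sum_comm]
  have hbound : ∀ x c, ‖Finsupp.linearCombination 𝕜 (v x) c‖ ≤ √‖A‖ * ‖β c‖ := fun x c => by
    refine le_of_sq_le_sq ?_ (by positivity)
    rw [mul_pow, Real.sq_sqrt (norm_nonneg A)]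
    calc ‖Finsupp.linearCombination 𝕜 (v x) c‖ ^ 2
        ≤ ∑ y, ‖Finsupp.linearCombination 𝕜 (v y) c‖ ^ 2 :=
          Finset.single_le_sum (f := fun y => ‖Finsupp.linearCombination 𝕜 (v y) c‖ ^ 2)
            (fun _ _ => sq_nonneg _) (Finset.mem_univ x)
      _ = RCLike.re (inner 𝕜 (β c) (A (β c))) := by
          simp only [← hsum, map_sum, inner_self_eq_norm_sq]
      _ ≤ ‖β c‖ * ‖A (β c)‖ := (RCLike.re_le_norm _).trans (norm_inner_le_norm _ _)
      _ ≤ ‖β c‖ * (‖A‖ * ‖β c‖) := by gcongr; exact A.le_opNorm _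
      _ = ‖A‖ * ‖β c‖ ^ 2 := by ring
  refine ⟨fun x => (Finsupp.linearCombination 𝕜 (v x)).extendOfNorm β, fun x i => ?_⟩
  have h := LinearMap.extendOfNorm_eq hdense ⟨√‖A‖, hbound x⟩ (.single i 1)
  simpa [β] using h

theorem continuousLinearMap_ext_hilbertBasis {𝕜 H I : Type*} [RCLike 𝕜]
    [NormedAddCommGroup H] [InnerProductSpace 𝕜 H] (b : HilbertBasis I 𝕜 H) {A B : H →L[𝕜] H}
    (h : ∀ i j, inner 𝕜 (b i) (A (b j)) = inner 𝕜 (b i) (B (b j))) : A = B := by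
  have hdense := Submodule.dense_iff_topologicalClosure_eq_top.2 b.dense_span
  refine ContinuousLinearMap.ext_on hdense (Set.forall_mem_range.2 fun j => ?_)
  refine b.repr.injective (lp.ext (funext fun i => ?_))
  rw [b.repr_apply_apply, b.repr_apply_apply, h]

theorem exists_sum_star_mul_self_eq_sum_adjoint_comp {𝕜 G H ν : Type*} [RCLike 𝕜] [Group G]
    [NormedAddCommGroup H] [InnerProductSpace 𝕜 H] [CompleteSpace H] [Fintype ν] {E : Finset G}
    (V : E → H →L[𝕜] PiLp 2 fun _ : ν => H) :
    ∃ ξ : ν → MonoidAlgebra (H →L[𝕜] H) G, (∀ z, (ξ z).coeff.support ⊆ E) ∧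
      ∑ z, star (ξ z) * ξ z = ∑ x : E, ∑ y : E,
        MonoidAlgebra.single ((x : G)⁻¹ * y) (ContinuousLinearMap.adjoint (V x) ∘L V y) := by
  let B : ν → E → H →L[𝕜] H := fun z x => PiLp.proj 2 (𝕜 := 𝕜) (fun _ : ν => H) z ∘L V x
  have hB : ∀ x y, ∑ z, star (B z x) * B z y = ContinuousLinearMap.adjoint (V x) ∘L V y := by
    intro x y
    refine ContinuousLinearMap.ext fun h => ext_inner_left 𝕜 fun h' => ?_
    rw [ContinuousLinearMap.comp_apply, ContinuousLinearMap.adjoint_inner_right, PiLp.inner_apply,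
      sum_apply, inner_sum]
    refine Finset.sum_congr rfl fun z _ => ?_
    rw [mul_apply_eq_comp, ContinuousLinearMap.star_eq_adjoint,
      ContinuousLinearMap.adjoint_inner_right]
    rfl
  refine ⟨fun z => ∑ x : E, .single (x : G) (B z x), fun z a ha => ?_, ?_⟩
  · by_contra haE
    refine Finsupp.mem_support_iff.1 ha ?_
    rw [MonoidAlgebra.coeff_sum, Finsupp.finsetSum_apply]
    refine Finset.sum_eq_zero fun x _ => ?_
    rw [MonoidAlgebra.coeff_single, Finsupp.single_eq_of_ne]
    rintro rfl
    exact haE x.2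
  · simp only [star_sum, Finset.sum_mul_sum, groupAlgebra_star_single,
      MonoidAlgebra.single_mul_single]
    rw [Finset.sum_comm]
    refine Finset.sum_congr rfl fun x _ => ?_
    rw [Finset.sum_comm]
    refine Finset.sum_congr rfl fun y _ => ?_
    rw [← hB, ← MonoidAlgebra.singleAddHom_apply, map_sum]
    rfl

/-- The index `(x⁻¹y, i, j)` of the entry in row `(x, i)` and column `(y, j)` of a kernel on
`E × I`. The kernels that depend on this index only are the block Toeplitz ones. -/
def toeplitzIndex {G : Type*} [Group G] (E : Finset G) (I : Type*) (pq : (E × I) × (E × I)) :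
    G × I × I :=
  ((pq.1.1 : G)⁻¹ * pq.2.1, pq.1.2, pq.2.2)

section

variable {G I : Type*} [Group G] (E : Finset G)

theorem preimage_toeplitzIndex_singleton_finite (t : G × I × I) :
    (toeplitzIndex E I ⁻¹' {t}).Finite := by
  refine (Set.finite_range fun xy : E × E => ((xy.1, t.2.1), (xy.2, t.2.2))).subset ?_
  rintro ⟨⟨x, i⟩, ⟨y, j⟩⟩ rfl
  exact ⟨(x, y), rfl⟩

theorem eq_of_toeplitzIndex_eq_diag {p q s : E × I}
    (h : toeplitzIndex E I (p, q) = toeplitzIndex E I (s, s)) : p = q := by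
  obtain ⟨hx, hi, hj⟩ := by simpa [toeplitzIndex, Prod.ext_iff] using h
  exact Prod.ext (Subtype.ext (inv_mul_eq_one.1 hx)) (hi.trans hj.symm)

theorem sum_fiber_toeplitzIndex {M : Type*} [AddCommMonoid M] [DecidableEq G] (a : G) (i j : I)
    (F : (E × I) × (E × I) → M) :
    ∑ pq ∈ (preimage_toeplitzIndex_singleton_finite E (a, i, j)).toFinset, F pq =
      ∑ x : E, ∑ y : E, if (x : G)⁻¹ * y = a then F ((x, i), (y, j)) else 0 := by
  rw [← Finset.sum_product', ← Finset.sum_filter]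
  symm
  refine Finset.sum_nbij' (fun xy => ((xy.1, i), (xy.2, j))) (fun pq => (pq.1.1, pq.2.1))
    ?_ ?_ ?_ ?_ ?_
  · simp [toeplitzIndex]
  · simp +contextual [toeplitzIndex]
  · simp
  · simp +contextual [toeplitzIndex]
  · simp

end

theorem orthonormal_piLp_single {𝕜 H I ν : Type*} [RCLike 𝕜] [NormedAddCommGroup H]
    [InnerProductSpace 𝕜 H] [Fintype ν] [DecidableEq ν] {b : I → H} (hb : Orthonormal 𝕜 b) :
    Orthonormal 𝕜 fun zi : ν × I => PiLp.single 2 (β := fun _ : ν => H) zi.1 (b zi.2) := by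
  classical
  rw [orthonormal_iff_ite] at hb ⊢
  rintro ⟨z, i⟩ ⟨z', j⟩
  rw [PiLp.inner_apply, Fintype.sum_eq_single z fun z'' hz => by
    rw [PiLp.single_eq_of_ne _ hz, inner_zero_left]]
  rcases eq_or_ne z z' with rfl | hz
  · rw [PiLp.single_eq_same, PiLp.single_eq_same, hb]
    simp
  · rw [PiLp.single_eq_of_ne _ hz, inner_zero_right, if_neg fun h => hz (congrArg Prod.fst h)]

theorem IsGrounded.exists_sum_star_mul_self_of_embedding {𝕜 H I ν : Type*} [RCLike 𝕜]
    [NormedAddCommGroup H] [InnerProductSpace 𝕜 H] [CompleteSpace H] [Fintype ν] {d : ℕ}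
    {f : MonoidAlgebra (H →L[𝕜] H) (FreeGroup (Fin d))} (hf : IsSelfAdjoint f)
    {E : Finset (FreeGroup (Fin d))} (hE : IsGrounded (E : Set (FreeGroup (Fin d))))
    (hfE : (f.coeff.support : Set (FreeGroup (Fin d))) ⊆ (E : Set (FreeGroup (Fin d)))⁻¹ * E)
    (hpos : ∀ (m : ℕ) (π : FreeGroup (Fin d) →*
        unitary (EuclideanSpace 𝕜 (Fin m) →L[𝕜] EuclideanSpace 𝕜 (Fin m))),
      (m : ℕ∞) ≤ E.card * Cardinal.toENat (Module.rank 𝕜 H) → (evalRep π f).IsPositive)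
    (b : HilbertBasis I 𝕜 H) (ε : E × I ↪ ν × I) :
    ∃ ξ : ν → MonoidAlgebra (H →L[𝕜] H) (FreeGroup (Fin d)),
      (∀ z, (ξ z).coeff.support ⊆ E) ∧ f = ∑ z, star (ξ z) * ξ z := by
  classical
  obtain ⟨T, hT, hTc⟩ := exists_posSemidef_fiber_sum_eq
    (preimage_toeplitzIndex_singleton_finite E) (fun _ _ _ => eq_of_toeplitzIndex_eq_diag E)
    (fun t => inner 𝕜 (b t.2.1) (f.coeff t.1 (b t.2.2)))
    fun w hw => hE.re_finsuppSum_inner_nonneg hf hfE b.orthonormal.linearIndependent hpos hw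
  obtain ⟨v, hv⟩ := exists_inner_eq_of_posSemidef
    ((orthonormal_piLp_single (ν := ν) b.orthonormal).comp ε ε.injective) hT
  have hsum : ∀ a i j, (∑ x : E, ∑ y : E,
      if (x : FreeGroup (Fin d))⁻¹ * y = a then inner 𝕜 (v (x, i)) (v (y, j)) else 0) =
        inner 𝕜 (b i) (f.coeff a (b j)) := fun a i j => by
    rw [← hTc (a, i, j), sum_fiber_toeplitzIndex]
    simp only [hv]
  obtain ⟨V, hV⟩ := exists_continuousLinearMap_apply_hilbertBasis b (v := fun x i => v (x, i))
    (A := f.coeff 1) fun i j => by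
      rw [← hsum 1 i j]
      simp [inv_mul_eq_one]
  obtain ⟨ξ, hξ, hξV⟩ := exists_sum_star_mul_self_eq_sum_adjoint_comp V
  refine ⟨ξ, hξ, ?_⟩
  rw [hξV]
  ext1
  ext1 a
  refine continuousLinearMap_ext_hilbertBasis b fun i j => ?_
  rw [← hsum]
  simp only [MonoidAlgebra.coeff_sum, Finsupp.finsetSum_apply, MonoidAlgebra.coeff_single,
    Finsupp.single_apply, sum_apply, inner_sum]
  refine Finset.sum_congr rfl fun x _ => Finset.sum_congr rfl fun y _ => ?_
  split_ifs
  · rw [ContinuousLinearMap.comp_apply, ContinuousLinearMap.adjoint_inner_right, hV, hV]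
  · rw [zero_apply, inner_zero_right]

theorem IsGrounded.exists_finset_subset_inv_mul {d : ℕ} {E : Set (FreeGroup (Fin d))}
    (hE : IsGrounded E) {A : Finset (FreeGroup (Fin d))}
    (hA : (A : Set (FreeGroup (Fin d))) ⊆ E⁻¹ * E) :
    ∃ F : Finset (FreeGroup (Fin d)), IsGrounded (F : Set (FreeGroup (Fin d))) ∧
      (F : Set (FreeGroup (Fin d))) ⊆ E ∧ (F.card : ℕ∞) ≤ E.encard ∧
      (A : Set (FreeGroup (Fin d))) ⊆ (F : Set (FreeGroup (Fin d)))⁻¹ * F := by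
  obtain ⟨S, T, hS, hT, hAST⟩ := Finset.subset_mul hA
  obtain ⟨F, hF, hBF, hFE⟩ := hE.exists_finset (B := S⁻¹ ∪ T) <| by
    rw [Finset.coe_union, Finset.coe_inv]
    exact Set.union_subset (Set.inv_subset.2 hS) hT
  rw [Finset.union_subset_iff] at hBF
  refine ⟨F, hF, hFE, ?_, fun a ha => ?_⟩
  · rw [← Set.encard_coe_eq_coe_finsetCard]
    exact Set.encard_le_encard hFE
  · obtain ⟨x, hx, y, hy, rfl⟩ := Finset.mem_mul.1 (hAST ha)
    exact Set.mul_mem_mul (hBF.1 (Finset.inv_mem_inv hx)) (hBF.2 hy)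

theorem infinite_of_hilbertBasis {𝕜 H I : Type*} [RCLike 𝕜] [NormedAddCommGroup H]
    [InnerProductSpace 𝕜 H] (b : HilbertBasis I 𝕜 H) (hH : ¬FiniteDimensional 𝕜 H) :
    Infinite I := by
  by_contra hI
  have := not_infinite_iff_finite.1 hI
  have := Fintype.ofFinite I
  exact hH (Module.Basis.finiteDimensional_of_finite b.toOrthonormalBasis.toBasis)

theorem nonempty_embedding_prod_self (α I : Type*) [Finite α] [Infinite I] :
    Nonempty (α × I ↪ I) := by
  obtain ⟨j⟩ : Nonempty (I × I ≃ I) :=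
    Cardinal.eq.1 (Cardinal.mul_eq_self (Cardinal.aleph0_le_mk I))
  exact ⟨(((Finite.equivFin α).toEmbedding.trans
    (Fin.valEmbedding.trans (Infinite.natEmbedding I))).prodMap (.refl I)).trans j.toEmbedding⟩

section

variable {𝕜 H : Type*} [RCLike 𝕜] [NormedAddCommGroup H] [InnerProductSpace 𝕜 H] [CompleteSpace H]
  {d : ℕ} {f : MonoidAlgebra (H →L[𝕜] H) (FreeGroup (Fin d))} {E : Set (FreeGroup (Fin d))}

theorem IsGrounded.exists_fin_sum_star_mul_self (hf : IsSelfAdjoint f) (hE : IsGrounded E)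
    (hfE : (f.coeff.support : Set (FreeGroup (Fin d))) ⊆ E⁻¹ * E)
    (hpos : ∀ (m : ℕ) (π : FreeGroup (Fin d) →*
        unitary (EuclideanSpace 𝕜 (Fin m) →L[𝕜] EuclideanSpace 𝕜 (Fin m))),
      (m : ℕ∞) ≤ E.encard * Cardinal.toENat (Module.rank 𝕜 H) → (evalRep π f).IsPositive) :
    ∃ n : ℕ, (n : ℕ∞) ≤ E.encard ∧
      ∃ ξ : Fin n → MonoidAlgebra (H →L[𝕜] H) (FreeGroup (Fin d)),
        (∀ i, ((ξ i).coeff.support : Set (FreeGroup (Fin d))) ⊆ E) ∧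
        f = ∑ i, star (ξ i) * ξ i := by
  obtain ⟨F, hF, hFE, hcard, hfF⟩ := hE.exists_finset_subset_inv_mul hfE
  obtain ⟨I, b, -⟩ := exists_hilbertBasis 𝕜 H
  obtain ⟨ξ, hξ, hfξ⟩ := hF.exists_sum_star_mul_self_of_embedding hf hfF
    (fun m π hm => hpos m π (hm.trans (by gcongr))) b
    (F.equivFin.toEmbedding.prodMap (.refl I))
  exact ⟨F.card, hcard, ξ, fun i => (Finset.coe_subset.2 (hξ i)).trans hFE, hfξ⟩

theorem IsGrounded.exists_star_mul_self (hf : IsSelfAdjoint f) (hE : IsGrounded E)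
    (hfE : (f.coeff.support : Set (FreeGroup (Fin d))) ⊆ E⁻¹ * E)
    (hpos : ∀ (m : ℕ) (π : FreeGroup (Fin d) →*
        unitary (EuclideanSpace 𝕜 (Fin m) →L[𝕜] EuclideanSpace 𝕜 (Fin m))),
      (m : ℕ∞) ≤ E.encard * Cardinal.toENat (Module.rank 𝕜 H) → (evalRep π f).IsPositive)
    (hH : ¬FiniteDimensional 𝕜 H) :
    ∃ ξ : MonoidAlgebra (H →L[𝕜] H) (FreeGroup (Fin d)),
      (ξ.coeff.support : Set (FreeGroup (Fin d))) ⊆ E ∧ f = star ξ * ξ := by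
  obtain ⟨F, hF, hFE, hcard, hfF⟩ := hE.exists_finset_subset_inv_mul hfE
  obtain ⟨I, b, -⟩ := exists_hilbertBasis 𝕜 H
  have := infinite_of_hilbertBasis b hH
  obtain ⟨j⟩ := nonempty_embedding_prod_self F I
  obtain ⟨ξ, hξ, hfξ⟩ := hF.exists_sum_star_mul_self_of_embedding hf hfF
    (fun m π hm => hpos m π (hm.trans (by gcongr))) b
    (j.trans (Equiv.punitProd I).symm.toEmbedding)
  refine ⟨ξ (), (Finset.coe_subset.2 (hξ ())).trans hFE, ?_⟩
  simpa using hfξ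

end

theorem isArchClosed_sosCone_freeGroup (𝕜 : Type*) [RCLike 𝕜] (d : ℕ) :
    IsArchClosed 𝕜 (sosCone (MonoidAlgebra 𝕜 (FreeGroup (Fin d)))) := by
  refine sosCone_subset_archClosure.antisymm fun f hf => ?_
  have hφf := map_mem_archClosure_sosCone scalarToOperator hf
  obtain ⟨n, -, ξ, -, hξ⟩ := (isGrounded_univ d).exists_fin_sum_star_mul_self hφf.1
    (by simp) fun m π _ => isPositive_evalRep_of_mem_archClosure π hφf
  have h := map_mem_sosCone scalarToOperator.symm (a := scalarToOperator f) ⟨n, ξ, hξ⟩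
  rwa [StarAlgEquiv.symm_apply_apply] at h

theorem mainTheorem4_general (𝕜 : Type*) [RCLike 𝕜] (d : ℕ) :
    (∀ (H : Type*) [NormedAddCommGroup H] [InnerProductSpace 𝕜 H] [CompleteSpace H]
      (f : MonoidAlgebra (H →L[𝕜] H) (FreeGroup (Fin d))) (E : Set (FreeGroup (Fin d))),
      IsSelfAdjoint f → IsGrounded E → (f.coeff.support : Set (FreeGroup (Fin d))) ⊆ E⁻¹ * E →
      (∀ (m : ℕ) (π : FreeGroup (Fin d) →*
          unitary (EuclideanSpace 𝕜 (Fin m) →L[𝕜] EuclideanSpace 𝕜 (Fin m))),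
        (m : ℕ∞) ≤ E.encard * Cardinal.toENat (Module.rank 𝕜 H) →
        (evalRep π f).IsPositive) →
      (∃ n : ℕ, (n : ℕ∞) ≤ E.encard ∧
        ∃ ξ : Fin n → MonoidAlgebra (H →L[𝕜] H) (FreeGroup (Fin d)),
          (∀ i, ((ξ i).coeff.support : Set (FreeGroup (Fin d))) ⊆ E) ∧
          f = ∑ i, star (ξ i) * ξ i) ∧
      (¬ FiniteDimensional 𝕜 H →
        ∃ ξ : MonoidAlgebra (H →L[𝕜] H) (FreeGroup (Fin d)),
          (ξ.coeff.support : Set (FreeGroup (Fin d))) ⊆ E ∧ f = star ξ * ξ)) ∧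
    IsArchClosed 𝕜 (sosCone (MonoidAlgebra 𝕜 (FreeGroup (Fin d)))) := by
  exact ⟨fun H _ _ _ f E hf hE hfE hpos => ⟨hE.exists_fin_sum_star_mul_self hf hfE hpos,
    hE.exists_star_mul_self hf hfE hpos⟩, isArchClosed_sosCone_freeGroup 𝕜 d⟩

theorem mainTheorem4 (𝕜 : Type*) [RCLike 𝕜] (d : ℕ) :
    (∀ (H : Type*) [NormedAddCommGroup H] [InnerProductSpace 𝕜 H] [CompleteSpace H]
      (f : MonoidAlgebra (H →L[𝕜] H) (FreeGroup (Fin d))) (E : Set (FreeGroup (Fin d))),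
      IsSelfAdjoint f → IsGrounded E → (f.coeff.support : Set (FreeGroup (Fin d))) ⊆ E⁻¹ * E →
      (∀ (m : ℕ) (π : FreeGroup (Fin d) →*
          unitary (EuclideanSpace 𝕜 (Fin m) →L[𝕜] EuclideanSpace 𝕜 (Fin m))),
        (m : ℕ∞) ≤ 2 * E.encard * Cardinal.toENat (Module.rank 𝕜 H) →
        (evalRep π f).IsPositive) →
      (∃ n : ℕ, (n : ℕ∞) ≤ E.encard ∧
        ∃ ξ : Fin n → MonoidAlgebra (H →L[𝕜] H) (FreeGroup (Fin d)),
          (∀ i, ((ξ i).coeff.support : Set (FreeGroup (Fin d))) ⊆ E) ∧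
          f = ∑ i, star (ξ i) * ξ i) ∧
      (¬ FiniteDimensional 𝕜 H →
        ∃ ξ : MonoidAlgebra (H →L[𝕜] H) (FreeGroup (Fin d)),
          (ξ.coeff.support : Set (FreeGroup (Fin d))) ⊆ E ∧ f = star ξ * ξ)) ∧
    IsArchClosed 𝕜 (sosCone (MonoidAlgebra 𝕜 (FreeGroup (Fin d)))) := by
  exact (mainTheorem4_general 𝕜 d).imp_left fun h H _ _ _ f E hf hE hfE hpos =>
    h H f E hf hE hfE fun m π hm => hpos m π (hm.trans (by gcongr; simp [two_mul]))
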